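/- Let $E$ be a non-empty Lusin space (a space homeomorphic to a Borel subset of a compact metric space) with Borel $\sigma$-algebra $\mathscr E$, and let $X=(\Omega,(X_t)_{t\ge 0},(\mathbb P_x)_{x\in E})$ be a conservative Borel right process with values in $E$: a normal ($\mathbb P_x(X_0=x)=1$), time-homogeneous Markov process with Borel transition function, with right-continuous paths in $E$ defined for all times, with shift operators $\theta_t$ ($X_s\circ\theta_t=X_{s+t}$), and with the strong Markov property relative to some right-continuous filtration to which $X$ is adapted. Let $(\mathscr F_t)$ be the minimum augmented filtration of $X$, i.e. $\mathscr F_t=\bigcap_\mu \sigma(\mathscr F^0_t,\mathcal N_\mu)$, where $\mathscr F^0_t=\sigma(X_s,s\le t)$, $\mu$ runs through all probability measures on $E$, and $\mathcal N_\mu$ is the family of null sets of the completion of $\mathbb P_\mu=\int\mathbb P_x\,\mu(dx)$ on $\sigma(X_s,s\ge 0)$. "Almost surely" means $\mathbb P_x$-almost surely for every $x\in E$. Let the pricing kernel $S=(S_t)_{t\ge0}$ be an $(\mathscr F_t)$-adapted process that is a semimartingale under every $\mathbb P_x$ and satisfies, almost surely, $S_0=1$, $S_{t+s}=S_t\cdot(S_s\circ\theta_t)$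 for each $s,t\ge 0$, $S_t>0$ for all $t\ge 0$ and $S_{t-}>0$ for all $t>0$, and let $\mathbb E_x[S_t]<\infty$ for all $t\geq 0$, $x\in E$. A *Hansen–Scheinkman factorization* of $S$ is a triple $(\lambda,\pi,M)$ consisting of $\lambda\in\mathbb R$, a Borel function $\pi:E\to(0,\infty)$ with $\mathbb E_x[S_t\pi(X_t)]=e^{-\lambda t}\pi(x)$ for all $t\ge0$, $x\in E$, and a process $M$ which is almost surely positive with $M_0=1$ and is a martingale with respect to $(\mathscr F_t)$ under every $\mathbb P_x$, such that almost surely $$S_t=e^{-\lambda t}\,\frac{\pi(X_0)}{\pi(X_t)}\,M_t\qquad\text{for all } t\ge 0.$$ Its eigen-measures are the $\mathbb Q_x$, $x\in E$, given by $\mathbb Q_x|_{\mathscr F_t}=M_t\,\mathbb P_x|_{\mathscr F_t}$ for each $t\ge0$. The factorization is *recurrent* if $X$ is recurrent under $(\mathbb Q_x)_{x\in E}$, that is, with $R(x,B)=\int_0^\infty \mathbb Q_x(X_t\in B)\,dt$, for each universally measurable $B\subseteq E$ either $R(x,B)=0$ for all $x\in E$, or $R(x,B)=\infty$ for all $x\in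 E$. Then $S$ admits at most one recurrent Hansen–Scheinkman factorization: if $(\lambda_1,\pi_1,M_1)$ and $(\lambda_2,\pi_2,M_2)$ are recurrent Hansen–Scheinkman factorizations of $S$, then $\lambda_1=\lambda_2$, there is a constant $c>0$ with $\pi_1(x)=c\,\pi_2(x)$ for all $x\in E$, the processes $M_1$ and $M_2$ are almost surely equal at all times, and the eigen-measures coincide on every $\mathscr F_t$. -/

import Mathlib

open MeasureTheory ProbabilityTheory Filter Set Topology
open scoped NNReal ENNReal

/-- A Lusin topological space: a space homeomorphic to a Borel subset of a compact metric space.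
(Compact metric spaces embed in the Hilbert cube, so taking `K : Type` is no restriction.) -/
class LusinSpace (E : Type*) [TopologicalSpace E] : Prop where
  exists_embedding : ∃ (K : Type) (_ : MetricSpace K) (_ : CompactSpace K) (_ : MeasurableSpace K)
    (_ : BorelSpace K) (f : E → K), IsEmbedding f ∧ MeasurableSet (range f)

/-- A set is universally measurable if it is measurable for the completion of every finite
measure. -/
def UniversallyMeasurableSet {E : Type*} [MeasurableSpace E] (B : Set E) : Prop :=
  ∀ μ : Measure E, IsFiniteMeasure μ → NullMeasurableSet B μ

/-! ### Semimartingales -/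

/-- Right-continuous functions with left limits. -/
structure IsCadlag (f : ℝ≥0 → ℝ) : Prop where
  right_cont : ∀ t, ContinuousWithinAt f (Ici t) t
  left_lim : ∀ t, 0 < t → ∃ l, Tendsto f (𝓝[<] t) (𝓝 l)

/-- Càdlàg local martingales. -/
structure IsLocalMartingale {Ω : Type*} {m : MeasurableSpace Ω} (N : ℝ≥0 → Ω → ℝ)
    (𝓕 : Filtration ℝ≥0 m) (P : Measure Ω) : Prop where
  adapted : StronglyAdapted 𝓕 N
  cadlag : ∀ᵐ ω ∂P, IsCadlag fun t => N t ω
  locally_martingale : Locally (fun Y => Martingale Y 𝓕 P) 𝓕 N P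

/-- Càdlàg adapted processes with paths of finite variation on bounded intervals. -/
structure IsFiniteVariationProcess {Ω : Type*} {m : MeasurableSpace Ω} (A : ℝ≥0 → Ω → ℝ)
    (𝓕 : Filtration ℝ≥0 m) (P : Measure Ω) : Prop where
  adapted : StronglyAdapted 𝓕 A
  cadlag : ∀ᵐ ω ∂P, IsCadlag fun t => A t ω
  finite_variation : ∀ᵐ ω ∂P, LocallyBoundedVariationOn (fun t => A t ω) univ

/-- Semimartingales: adapted càdlàg processes that are the sum of a local martingale and a process
of finite variation. -/
structure IsSemimartingale {Ω : Type*} {m : MeasurableSpace Ω} (Y : ℝ≥0 → Ω → ℝ)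
    (𝓕 : Filtration ℝ≥0 m) (P : Measure Ω) : Prop where
  adapted : StronglyAdapted 𝓕 Y
  cadlag : ∀ᵐ ω ∂P, IsCadlag fun t => Y t ω
  exists_decomposition : ∃ N A : ℝ≥0 → Ω → ℝ, IsLocalMartingale N 𝓕 P ∧
    IsFiniteVariationProcess A 𝓕 P ∧ ∀ᵐ ω ∂P, ∀ t, Y t ω = N t ω + A t ω

/-! ### Borel right processes -/

/-- The strong Markov property of `X`, under the laws `P_μ = ∫ P_x μ(dx)` of all initial
distributions `μ`, relative to the filtration `𝓜`:
`P_μ(X_{σ+s} ∈ B | 𝓜_σ) = P_{X_σ}(X_s ∈ B)` holds `P_μ`-a.s. on `{σ < ∞}`. -/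
def HasStrongMarkovProperty {E Ω : Type*} [MeasurableSpace E] {mΩ : MeasurableSpace Ω}
    (X : ℝ≥0 → Ω → E) (P : Kernel E Ω) (𝓜 : Filtration ℝ≥0 mΩ) : Prop :=
  ∀ (σ : Ω → WithTop ℝ≥0) (hσ : IsStoppingTime 𝓜 σ) (μ : Measure E), IsProbabilityMeasure μ →
    ∀ (s : ℝ≥0) (B : Set E), MeasurableSet B →
      (μ.bind P)[({ω | σ ω < ⊤ ∧ X ((σ ω).untopA + s) ω ∈ B}).indicator (fun _ => (1 : ℝ)) |
          hσ.measurableSpace]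
        =ᵐ[(μ.bind P).restrict {ω | σ ω < ⊤}]
      fun ω => (P (X (σ ω).untopA ω)).real {ω' | X s ω' ∈ B}

/-- A conservative Borel right process with state space `E`. The σ-algebra carried by `Ω` is
`𝓕⁰_∞ = σ(X_s, s ≥ 0)`, and the laws `P_x`, `x ∈ E`, form a Markov kernel. The process is
conservative because all its paths stay in `E` for all times. -/
structure BorelRightProcess (E Ω : Type*) [TopologicalSpace E] [MeasurableSpace E] [BorelSpace E]
    [LusinSpace E] [mΩ : MeasurableSpace Ω] where
  /-- the process -/
  X : ℝ≥0 → Ω → E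
  /-- the law of the process started at `x` -/
  P : Kernel E Ω
  /-- the shift operators -/
  θ : ℝ≥0 → Ω → Ω
  isMarkovKernel : IsMarkovKernel P
  generates : mΩ = ⨆ t, MeasurableSpace.comap (X t) inferInstance
  normal : ∀ x, ∀ᵐ ω ∂(P x), X 0 ω = x
  shift : ∀ t s ω, X s (θ t ω) = X (s + t) ω
  right_cont : ∀ ω t, ContinuousWithinAt (fun s => X s ω) (Ici t) t
  strong_markov : ∃ 𝓜 : Filtration ℝ≥0 mΩ, 𝓜.IsRightContinuous ∧
    (∀ t, Measurable[𝓜 t] (X t)) ∧ HasStrongMarkovProperty X P 𝓜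

namespace BorelRightProcess

variable {E Ω : Type*} [TopologicalSpace E] [MeasurableSpace E] [BorelSpace E] [LusinSpace E]
  [mΩ : MeasurableSpace Ω] (𝕏 : BorelRightProcess E Ω)

/-- The law `P_μ` on `𝓕⁰_∞` of the process with initial distribution `μ`. -/
noncomputable def initialLaw (μ : Measure E) : Measure Ω := μ.bind 𝕏.P

/-- The σ-algebra `𝓕⁰_t = σ(X_s, s ≤ t)`. -/
@[reducible] noncomputable def rawSigma (t : ℝ≥0) : MeasurableSpace Ω :=
  ⨆ s : ℝ≥0, ⨆ _ : s ≤ t, MeasurableSpace.comap (𝕏.X s) inferInstance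

/-- The universal completion `𝓕_∞ = ⋂_μ 𝓕^μ_∞` of `𝓕⁰_∞`, where `𝓕^μ_∞` is the completion under
`P_μ` and `μ` runs through all probability measures on `E`. -/
@[reducible] noncomputable def sigmaInf : MeasurableSpace Ω :=
  ⨅ (μ : Measure E) (_ : IsProbabilityMeasure μ), eventuallyMeasurableSpace mΩ (ae (𝕏.initialLaw μ))

/-- The σ-algebra `𝓕_t = ⋂_μ 𝓕^μ_t`, where `𝓕^μ_t` is generated by `𝓕⁰_t` and all `P_μ`-null
sets, i.e. consists of the sets that differ from a set in `𝓕⁰_t` by a `P_μ`-null set. -/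
@[reducible] noncomputable def sigmaAt (t : ℝ≥0) : MeasurableSpace Ω :=
  ⨅ (μ : Measure E) (_ : IsProbabilityMeasure μ),
    eventuallyMeasurableSpace (𝕏.rawSigma t) (ae (𝕏.initialLaw μ))

/-- The minimum augmented admissible filtration `(𝓕_t)`. -/
noncomputable def filtration : Filtration ℝ≥0 𝕏.sigmaInf where
  seq := 𝕏.sigmaAt
  mono' := by
    intro s t hst
    refine iInf₂_mono fun μ _ => ?_
    rintro A ⟨B, hB, hAB⟩
    have hle : 𝕏.rawSigma s ≤ 𝕏.rawSigma t :=
      biSup_mono fun u (hu : u ≤ s) => hu.trans hst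
    exact ⟨B, hle B hB, hAB⟩
  le' := by
    intro t
    refine iInf₂_mono fun μ _ => ?_
    rintro A ⟨B, hB, hAB⟩
    have hle : 𝕏.rawSigma t ≤ mΩ := by
      conv_rhs => rw [𝕏.generates]
      exact iSup₂_le fun u _ => le_iSup (fun u => MeasurableSpace.comap (𝕏.X u) inferInstance) u
    exact ⟨B, hle B hB, hAB⟩

theorem sigmaInf_le (x : E) :
    𝕏.sigmaInf ≤ (inferInstance : MeasurableSpace (NullMeasurableSpace Ω (𝕏.P x))) := by
  have h : 𝕏.initialLaw (Measure.dirac x) = 𝕏.P x :=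
    Measure.dirac_bind 𝕏.P.measurable x
  have h' : (inferInstance : MeasurableSpace (NullMeasurableSpace Ω (𝕏.P x))) =
      eventuallyMeasurableSpace mΩ (ae (𝕏.initialLaw (Measure.dirac x))) := by
    rw [h]; rfl
  rw [h']
  exact iInf₂_le (Measure.dirac x) Measure.dirac.isProbabilityMeasure

/-- The law `P_x`, extended from `𝓕⁰_∞` to its universal completion `𝓕_∞`. -/
noncomputable def prob (x : E) : @Measure Ω 𝕏.sigmaInf :=
  @Measure.trim Ω 𝕏.sigmaInf _ (𝕏.P x).completion (𝕏.sigmaInf_le x)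

/-! ### Pricing kernels, eigenfunctions and recurrence -/

/-- A pricing kernel: a strictly positive semimartingale multiplicative functional `S` of the
process with `S_0 = 1`, strictly positive left limits and `E_x[S_t] < ∞`. -/
structure IsPricingKernel (S : ℝ≥0 → Ω → ℝ) : Prop where
  semimartingale : ∀ x, IsSemimartingale S 𝕏.filtration (𝕏.prob x)
  multiplicative : ∀ x t s, ∀ᵐ ω ∂(𝕏.prob x), S (t + s) ω = S t ω * S s (𝕏.θ t ω)
  initial : ∀ x, ∀ᵐ ω ∂(𝕏.prob x), S 0 ω = 1
  pos : ∀ x, ∀ᵐ ω ∂(𝕏.prob x), ∀ t, 0 < S t ω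
  left_lim_pos : ∀ x, ∀ᵐ ω ∂(𝕏.prob x), ∀ t, 0 < t →
    ∃ l, 0 < l ∧ Tendsto (fun s => S s ω) (𝓝[<] t) (𝓝 l)
  integrable : ∀ x t, Integrable (S t) (𝕏.prob x)

/-- The pricing operators `𝒫_t f(x) = E_x[S_t f(X_t)]`. -/
noncomputable def pricingOp (S : ℝ≥0 → Ω → ℝ) (t : ℝ≥0) (f : E → ℝ) (x : E) : ℝ :=
  ∫ ω, S t ω * f (𝕏.X t ω) ∂(𝕏.prob x)

/-- `π` is a strictly positive Borel function with `𝒫_t π = e^{-λt} π` for all `t`. (As the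
right-hand side does not vanish, the integral defining `𝒫_t π(x)` has to converge.) -/
structure IsPositiveEigenfunction (S : ℝ≥0 → Ω → ℝ) (lam : ℝ) (π : E → ℝ) : Prop where
  measurable : Measurable π
  pos : ∀ x, 0 < π x
  eigen : ∀ t x, 𝕏.pricingOp S t π x = Real.exp (-lam * t) * π x

/-- The Hansen–Scheinkman factorization `S_t = e^{-λt} π(X_0)/π(X_t) M_t`, where `π` is a positive
eigenfunction of the pricing operators and `M` is a positive martingale with `M_0 = 1`. -/
structure IsHansenScheinkmanFactorization (S : ℝ≥0 → Ω → ℝ) (lam : ℝ) (π : E → ℝ)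
    (M : ℝ≥0 → Ω → ℝ) : Prop where
  eigenfunction : 𝕏.IsPositiveEigenfunction S lam π
  martingale : ∀ x, Martingale M 𝕏.filtration (𝕏.prob x)
  pos : ∀ x, ∀ᵐ ω ∂(𝕏.prob x), ∀ t, 0 < M t ω
  initial : ∀ x, ∀ᵐ ω ∂(𝕏.prob x), M 0 ω = 1
  factorization : ∀ x, ∀ᵐ ω ∂(𝕏.prob x), ∀ t,
    S t ω = Real.exp (-lam * t) * (π (𝕏.X 0 ω) / π (𝕏.X t ω)) * M t ω

/-- The restriction to `𝓕_t` of the eigen-measure `Q_x` with martingale density `M`: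
`Q_x|_{𝓕_t} = M_t P_x|_{𝓕_t}`. -/
noncomputable def eigenMeasure (M : ℝ≥0 → Ω → ℝ) (t : ℝ≥0) (x : E) :
    @Measure Ω (𝕏.filtration t) :=
  ((𝕏.prob x).withDensity fun ω => ENNReal.ofReal (M t ω)).trim (𝕏.filtration.le t)

/-- The distribution `Q_x(X_t ∈ ·)` of `X_t` under the eigen-measure `Q_x`. -/
noncomputable def eigenTransition (M : ℝ≥0 → Ω → ℝ) (t : ℝ≥0) (x : E) : Measure E :=
  @Measure.map Ω E (𝕏.filtration t) _ (𝕏.X t) (𝕏.eigenMeasure M t x)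

end BorelRightProcess

/-- The potential `R(x, B) = ∫_0^∞ Q_t(x, B) dt` of the transition function `Q`. (A measure
evaluated at a universally measurable set gives the value of its completion there.) -/
noncomputable def potential {E : Type*} [MeasurableSpace E] (Q : ℝ≥0 → E → Measure E) (x : E)
    (B : Set E) : ℝ≥0∞ :=
  ∫⁻ t in Ioi (0 : ℝ), Q t.toNNReal x B

/-- Recurrence: for every universally measurable set `B`, either `R(x, B) = 0` for all `x`, or
`R(x, B) = ∞` for all `x`. -/
def IsRecurrentTransition {E : Type*} [MeasurableSpace E] (Q : ℝ≥0 → E → Measure E) : Prop :=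
  ∀ B : Set E, UniversallyMeasurableSet B →
    (∀ x, potential Q x B = 0) ∨ (∀ x, potential Q x B = ∞)

/-- A recurrent Hansen–Scheinkman factorization: the process is recurrent under the eigen-measures
`Q_x`. -/
structure BorelRightProcess.IsRecurrentFactorization {E Ω : Type*} [TopologicalSpace E]
    [MeasurableSpace E] [BorelSpace E] [LusinSpace E] [MeasurableSpace Ω]
    (𝕏 : BorelRightProcess E Ω) (S : ℝ≥0 → Ω → ℝ) (lam : ℝ) (π : E → ℝ) (M : ℝ≥0 → Ω → ℝ) :
    Prop where
  isFactorization : 𝕏.IsHansenScheinkmanFactorization S lam π M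
  recurrent : IsRecurrentTransition (𝕏.eigenTransition M)

/-! Under the eigen-measures of a factorization `(λ, π, M)` the process has transition function `Q_t
f = e^{λt} π⁻¹ 𝒫_t(π f)`, a Doob transform of the pricing operators. A second eigenpair `(λ', π')`
thus turns into the positive function `h = π'/π` with `Q_t h = e^{-(λ'-λ)t} h`. Taking for `Q` the
recurrent factorization with the smaller eigenvalue gives `Q_t h ≤ h`, and recurrence must force `h`
to be constant and the exponent to vanish (`eigenfunction_const`). Since `M` is determined by `S`,
`λ` and `π` up to scaling of `π`, everything else follows.

For the constancy, `h` is replaced by `g = h/(1+h)`, which is bounded, strictly increasing in `h`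
and, by Jensen, still satisfies `Q_t g ≤ g`. The decrease `f = g - Q_t g` has potential at most `t`
by telescoping, so each `{f > ε}` has finite, hence zero, potential (`ae_integral_add_eq`). This
yields a point `y` with `Q_t g(y) = g(y)` for all `t`. Equality in the strict Jensen inequality
makes `h = h(y)` almost surely under every `Q_t(y, ·)`, so the exponent is zero and `{h ≠ h(y)}` has
zero potential from `y`, hence by recurrence from every point. The eigenvalue equation then carries
the value `h(y)` to each `x`.

That `Q` is a transition function rests on the Markov property for functionals in the universal
completion (`lintegral_mul_comp_shift`), because `S_t` is adapted only to the augmented filtration.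
-/

/-! ### Jensen's inequality for `z ↦ z / (1 + z)` -/

/-- Tangent line at `a` with an exact remainder; its sign gives Jensen, its zeros the equality case.
-/
theorem div_one_add_eq_tangent_sub {z a : ℝ} (hz : 0 < z) (ha : 0 < a) :
    z / (1 + z) = a / (1 + a) + (z - a) / (1 + a) ^ 2
      - (z - a) ^ 2 / ((1 + a) ^ 2 * (1 + z)) := by
  have h1 : (1 + z) ≠ 0 := by positivity
  have h2 : (1 + a) ≠ 0 := by positivity
  field_simp
  ring

theorem integrable_of_measurable_of_mem_Icc {E : Type*} [MeasurableSpace E] {ν : Measure E}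
    [IsFiniteMeasure ν] {g : E → ℝ} (hg : AEStronglyMeasurable g ν) (h0 : ∀ x, 0 ≤ g x)
    (h1 : ∀ x, g x ≤ 1) : Integrable g ν :=
  Integrable.of_bound hg 1 (Eventually.of_forall fun x => by
    rw [Real.norm_of_nonneg (h0 x)]; exact h1 x)

theorem integrable_div_one_add {E : Type*} [MeasurableSpace E] {ν : Measure E}
    [IsFiniteMeasure ν] {h : E → ℝ} (hm : Measurable h) (hpos : ∀ x, 0 < h x) :
    Integrable (fun x => h x / (1 + h x)) ν :=
  integrable_of_measurable_of_mem_Icc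
    (hm.div (measurable_const.add hm)).aestronglyMeasurable
    (fun x => div_nonneg (hpos x).le (by linarith [hpos x]))
    (fun x => by rw [div_le_one (by linarith [hpos x])]; linarith)

/-- The defect in Jensen's inequality for `z ↦ z / (1 + z)`. -/
theorem integral_div_one_add_add_defect {E : Type*} [MeasurableSpace E] {ν : Measure E}
    [IsProbabilityMeasure ν] {h : E → ℝ} (hm : Measurable h) (hpos : ∀ x, 0 < h x)
    (hi : Integrable h ν) {a : ℝ} (ha : 0 < a) :
    Integrable (fun x => (h x - a) ^ 2 / ((1 + a) ^ 2 * (1 + h x))) ν ∧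
    ∫ x, h x / (1 + h x) ∂ν + ∫ x, (h x - a) ^ 2 / ((1 + a) ^ 2 * (1 + h x)) ∂ν
      = a / (1 + a) + (∫ x, h x ∂ν - a) / (1 + a) ^ 2 := by
  have hg := integrable_div_one_add (ν := ν) hm hpos
  have hd : Integrable (fun x => (h x - a) / (1 + a) ^ 2) ν :=
    (hi.sub (integrable_const a)).div_const _
  have hd' : Integrable (fun x => a / (1 + a) + (h x - a) / (1 + a) ^ 2) ν :=
    (integrable_const _).add hd
  have heq : (fun x => (h x - a) ^ 2 / ((1 + a) ^ 2 * (1 + h x)))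
      = fun x => (a / (1 + a) + (h x - a) / (1 + a) ^ 2) - h x / (1 + h x) := by
    funext x
    rw [div_one_add_eq_tangent_sub (hpos x) ha]
    ring
  refine ⟨heq ▸ hd'.sub hg, ?_⟩
  rw [heq, integral_sub hd' hg, integral_add (integrable_const _) hd,
    integral_div ((1 + a) ^ 2),
    integral_sub hi (integrable_const _)]
  simp

theorem integral_div_one_add_le {E : Type*} [MeasurableSpace E] {ν : Measure E}
    [IsProbabilityMeasure ν] {h : E → ℝ} (hm : Measurable h) (hpos : ∀ x, 0 < h x)
    (hi : Integrable h ν) {a : ℝ} (ha : 0 < a) (hle : ∫ x, h x ∂ν ≤ a) :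
    ∫ x, h x / (1 + h x) ∂ν ≤ a / (1 + a) := by
  have h1 := (integral_div_one_add_add_defect hm hpos hi ha).2
  have h2 : 0 ≤ ∫ x, (h x - a) ^ 2 / ((1 + a) ^ 2 * (1 + h x)) ∂ν :=
    integral_nonneg fun x => by have := hpos x; positivity
  have h3 : (∫ x, h x ∂ν - a) / (1 + a) ^ 2 ≤ 0 :=
    div_nonpos_of_nonpos_of_nonneg (by linarith) (by positivity)
  linarith

/-- The Jensen defect and the shortfall of the mean below `a` both lower the integral, so equality
forces both to vanish. -/
theorem eq_of_integral_div_one_add_eq {E : Type*} [MeasurableSpace E] {ν : Measure E}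
    [IsProbabilityMeasure ν] {h : E → ℝ} (hm : Measurable h) (hpos : ∀ x, 0 < h x)
    (hi : Integrable h ν) {a : ℝ} (ha : 0 < a) (hle : ∫ x, h x ∂ν ≤ a)
    (heq : ∫ x, h x / (1 + h x) ∂ν = a / (1 + a)) :
    ∫ x, h x ∂ν = a ∧ ∀ᵐ x ∂ν, h x = a := by
  obtain ⟨hdi, h1⟩ := integral_div_one_add_add_defect hm hpos hi ha
  have hnn : ∀ x, 0 ≤ (h x - a) ^ 2 / ((1 + a) ^ 2 * (1 + h x)) :=
    fun x => by have := hpos x; positivity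
  have h2 : 0 ≤ ∫ x, (h x - a) ^ 2 / ((1 + a) ^ 2 * (1 + h x)) ∂ν := integral_nonneg hnn
  have h3 : (∫ x, h x ∂ν - a) / (1 + a) ^ 2 ≤ 0 :=
    div_nonpos_of_nonpos_of_nonneg (by linarith) (by positivity)
  have h4 : ∫ x, (h x - a) ^ 2 / ((1 + a) ^ 2 * (1 + h x)) ∂ν = 0 := by linarith
  have h5 : (∫ x, h x ∂ν - a) / (1 + a) ^ 2 = 0 := by linarith
  constructor
  · have : (1 + a) ^ 2 ≠ 0 := by positivity
    rcases div_eq_zero_iff.1 h5 with h | h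
    · linarith
    · exact absurd h this
  · rw [integral_eq_zero_iff_of_nonneg hnn hdi] at h4
    filter_upwards [h4] with x hx
    have : (1 + a) ^ 2 * (1 + h x) ≠ 0 := by have := hpos x; positivity
    rcases div_eq_zero_iff.1 hx with h | h
    · have := pow_eq_zero_iff (two_ne_zero) |>.1 h
      linarith
    · exact absurd h this

/-! ### Recurrent transition functions -/

/-- A conservative transition function on the universally measurable sets. -/
structure IsUniversalTransition {E : Type*} [MeasurableSpace E] (Q : ℝ≥0 → E → Measure E) :
    Prop where
  isProbabilityMeasure : ∀ t x, IsProbabilityMeasure (Q t x)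
  aemeasurable : ∀ t (g : E → ℝ≥0∞), Measurable g → ∀ (μ : Measure E) [IsFiniteMeasure μ],
    AEMeasurable (fun y => ∫⁻ z, g z ∂Q t y) μ
  chapman_kolmogorov : ∀ s t x (g : E → ℝ≥0∞), Measurable g →
    ∫⁻ z, g z ∂Q (s + t) x = ∫⁻ y, ∫⁻ z, g z ∂Q t y ∂Q s x

namespace IsUniversalTransition

variable {E : Type*} [MeasurableSpace E] {Q : ℝ≥0 → E → Measure E}

theorem integral_mem_Icc (hQ : IsUniversalTransition Q) {g : E → ℝ} (hg : Measurable g)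
    (h0 : ∀ x, 0 ≤ g x) (h1 : ∀ x, g x ≤ 1) (t : ℝ≥0) (x : E) :
    0 ≤ ∫ z, g z ∂Q t x ∧ ∫ z, g z ∂Q t x ≤ 1 := by
  have := hQ.isProbabilityMeasure t x
  refine ⟨integral_nonneg h0, ?_⟩
  calc ∫ z, g z ∂Q t x ≤ ∫ _, (1 : ℝ) ∂Q t x :=
        integral_mono (integrable_of_measurable_of_mem_Icc hg.aestronglyMeasurable h0 h1)
          (integrable_const _) h1
    _ = 1 := by simp

theorem aemeasurable_integral (hQ : IsUniversalTransition Q) {g : E → ℝ} (hg : Measurable g)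
    (h0 : ∀ x, 0 ≤ g x) (t : ℝ≥0) (μ : Measure E) [IsFiniteMeasure μ] :
    AEMeasurable (fun y => ∫ z, g z ∂Q t y) μ := by
  have : (fun y => ∫ z, g z ∂Q t y)
      = fun y => (∫⁻ z, ENNReal.ofReal (g z) ∂Q t y).toReal := by
    funext y
    exact integral_eq_lintegral_of_nonneg_ae (Eventually.of_forall h0) hg.aestronglyMeasurable
  rw [this]
  exact (hQ.aemeasurable t _ hg.ennreal_ofReal μ).ennreal_toReal

theorem integral_integral (hQ : IsUniversalTransition Q) {g : E → ℝ} (hg : Measurable g)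
    (h0 : ∀ x, 0 ≤ g x) (h1 : ∀ x, g x ≤ 1) (s t : ℝ≥0) (x : E) :
    ∫ y, ∫ z, g z ∂Q t y ∂Q s x = ∫ z, g z ∂Q (s + t) x := by
  have := hQ.isProbabilityMeasure s x
  rw [integral_eq_lintegral_of_nonneg_ae (Eventually.of_forall fun y => integral_nonneg h0)
      (hQ.aemeasurable_integral hg h0 t _).aestronglyMeasurable,
    integral_eq_lintegral_of_nonneg_ae (Eventually.of_forall h0) hg.aestronglyMeasurable,
    hQ.chapman_kolmogorov s t x _ hg.ennreal_ofReal]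
  congr 1
  refine lintegral_congr fun y => ?_
  have := hQ.isProbabilityMeasure t y
  exact ofReal_integral_eq_lintegral_ofReal
    (integrable_of_measurable_of_mem_Icc hg.aestronglyMeasurable h0 h1) (Eventually.of_forall h0)

/-- The total decrease of a bounded antitone function over intervals of length `t` is finite. -/
theorem _root_.Antitone.lintegral_sub_comp_add_lt_top {u : ℝ → ℝ} (hu : Antitone u)
    (h0 : ∀ s, 0 ≤ u s) (h1 : ∀ s, u s ≤ 1) {t : ℝ} (ht : 0 ≤ t) :
    ∫⁻ s in Ioi (0 : ℝ), ENNReal.ofReal (u s - u (s + t)) < ∞ := by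
  have hu' : Antitone fun s => u (s + t) := fun a b hab => hu (by linarith)
  have hnn : ∀ s, 0 ≤ u s - u (s + t) := fun s => sub_nonneg.2 (hu (by linarith))
  have hii : ∀ a b, IntervalIntegrable (fun s => u s - u (s + t)) volume a b := fun a b =>
    hu.intervalIntegrable.sub hu'.intervalIntegrable
  have key : IntegrableOn (fun s => u s - u (s + t)) (Ioi 0) := by
    refine integrableOn_Ioi_of_intervalIntegral_norm_bounded (l := atTop) (b := fun n : ℕ => (n : ℝ))
      t 0 (fun n => ?_) tendsto_natCast_atTop_atTop (Eventually.of_forall fun n => ?_)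
    · exact (intervalIntegrable_iff_integrableOn_Ioc_of_le (by positivity)).1 (hii 0 n)
    · have e : (fun s => ‖u s - u (s + t)‖) = fun s => u s - u (s + t) :=
        funext fun s => Real.norm_of_nonneg (hnn s)
      have hi : ∀ a b, IntervalIntegrable u volume a b := fun a b => hu.intervalIntegrable
      -- Telescoping: only the end pieces over `[0, t]` and `[n, n + t]` survive.
      have e1 : ∫ s in (0 : ℝ)..n, u s - u (s + t)
          = (∫ s in (0 : ℝ)..t, u s) - ∫ s in (n : ℝ)..(n + t), u s := by
        rw [intervalIntegral.integral_sub (hi _ _) hu'.intervalIntegrable,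
          intervalIntegral.integral_comp_add_right u t, zero_add]
        have a1 := intervalIntegral.integral_add_adjacent_intervals (hi 0 n) (hi n (n + t))
        have a2 := intervalIntegral.integral_add_adjacent_intervals (hi 0 t) (hi t (n + t))
        linarith
      have e2 : ∫ s in (0 : ℝ)..t, u s ≤ t := by
        have := intervalIntegral.integral_mono_on ht (hi 0 t)
          (intervalIntegrable_const (c := (1 : ℝ))) fun s _ => h1 s
        simpa using this
      have e3 : 0 ≤ ∫ s in (n : ℝ)..(n + t), u s :=
        intervalIntegral.integral_nonneg (by linarith) fun s _ => h0 s
      rw [e, e1]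
      linarith
  have := key.2
  rw [HasFiniteIntegral] at this
  refine lt_of_le_of_lt (lintegral_mono fun s => ?_) this
  rw [Real.enorm_eq_ofReal (hnn s)]

/-- `Q_{a+t} g = Q_a (Q_t g) ≤ Q_a g`. -/
theorem antitone_integral (hQ : IsUniversalTransition Q) {g : E → ℝ} (hg : Measurable g)
    (h0 : ∀ x, 0 ≤ g x) (h1 : ∀ x, g x ≤ 1) (hsup : ∀ t x, ∫ z, g z ∂Q t x ≤ g x) (x : E) :
    Antitone fun s => ∫ z, g z ∂Q s x := by
  intro a b hab
  obtain ⟨t, rfl⟩ := exists_add_of_le hab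
  have := hQ.isProbabilityMeasure a x
  show ∫ z, g z ∂Q (a + t) x ≤ ∫ z, g z ∂Q a x
  rw [← hQ.integral_integral hg h0 h1]
  refine integral_mono ?_
    (integrable_of_measurable_of_mem_Icc hg.aestronglyMeasurable h0 h1) (hsup t)
  exact integrable_of_measurable_of_mem_Icc
    (hQ.aemeasurable_integral hg h0 t _).aestronglyMeasurable
    (fun y => (hQ.integral_mem_Icc hg h0 h1 t y).1) (fun y => (hQ.integral_mem_Icc hg h0 h1 t y).2)

/-- For a recurrent transition function, bounded supermedian functions are invariant almost
everywhere along the process. -/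
theorem ae_integral_add_eq (hQ : IsUniversalTransition Q) (hrec : IsRecurrentTransition Q)
    {g : E → ℝ} (hg : Measurable g) (h0 : ∀ x, 0 ≤ g x) (h1 : ∀ x, g x ≤ 1)
    (hsup : ∀ t x, ∫ z, g z ∂Q t x ≤ g x) (t : ℝ≥0) (x : E) :
    ∀ᵐ s ∂volume.restrict (Ioo (0 : ℝ) 1),
      ∫ z, g z ∂Q s.toNNReal x - ∫ z, g z ∂Q (s.toNNReal + t) x = 0 := by
  set f : E → ℝ := fun y => g y - ∫ z, g z ∂Q t y with hf
  have hf0 : ∀ y, 0 ≤ f y := fun y => sub_nonneg.2 (hsup t y)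
  have hf1 : ∀ y, f y ≤ 1 := fun y => by
    have := (hQ.integral_mem_Icc hg h0 h1 t y).1
    have := h1 y
    simp only [hf]; linarith
  have hfm : ∀ (μ : Measure E) [IsFiniteMeasure μ], AEMeasurable f μ := fun μ _ =>
    hg.aemeasurable.sub (hQ.aemeasurable_integral hg h0 t μ)
  have hfi : ∀ s y, Integrable f (Q s y) := fun s y => by
    have := hQ.isProbabilityMeasure s y
    exact integrable_of_measurable_of_mem_Icc (hfm _).aestronglyMeasurable hf0 hf1
  have hfint : ∀ s y, ∫ z, f z ∂Q s y = ∫ z, g z ∂Q s y - ∫ z, g z ∂Q (s + t) y := by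
    intro s y
    have := hQ.isProbabilityMeasure s y
    rw [← hQ.integral_integral hg h0 h1, hf]
    refine integral_sub (integrable_of_measurable_of_mem_Icc hg.aestronglyMeasurable h0 h1) ?_
    exact integrable_of_measurable_of_mem_Icc
      (hQ.aemeasurable_integral hg h0 t _).aestronglyMeasurable
      (fun y => (hQ.integral_mem_Icc hg h0 h1 t y).1)
      (fun y => (hQ.integral_mem_Icc hg h0 h1 t y).2)
  have hlint : ∀ s y, ∫⁻ z, ENNReal.ofReal (f z) ∂Q s y
      = ENNReal.ofReal (∫ z, g z ∂Q s y - ∫ z, g z ∂Q (s + t) y) := by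
    intro s y
    rw [← hfint, ofReal_integral_eq_lintegral_ofReal (hfi s y) (Eventually.of_forall hf0)]
  set u : ℝ → ℝ := fun s => ∫ z, g z ∂Q s.toNNReal x with hu
  have hua : Antitone u := fun a b hab =>
    hQ.antitone_integral hg h0 h1 hsup x (Real.toNNReal_le_toNNReal hab)
  have hus : ∀ s, 0 ≤ s → ∫ z, g z ∂Q (s.toNNReal + t) x = u (s + t) := by
    intro s hs
    simp only [hu]
    rw [Real.toNNReal_add hs t.coe_nonneg, Real.toNNReal_coe]
  -- `Q_t g`, hence `f`, need not be Borel; this is where recurrence for universally measurable sets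
  -- matters.
  have hB : ∀ ε : ℝ, 0 < ε → UniversallyMeasurableSet {y | ε < f y} := fun ε _ μ _ =>
    nullMeasurableSet_lt aemeasurable_const (hfm μ)
  have hpot : ∀ ε : ℝ, 0 < ε → potential Q x {y | ε < f y} = 0 := by
    intro ε hε
    refine (hrec _ (hB ε hε)).elim (fun h => h x) fun h => ?_
    exfalso
    have hlt : potential Q x {y | ε < f y} < ∞ := by
      -- Markov's inequality bounds `Q_s(x, {f > ε})` by `ε⁻¹ Q_s f(x)`, whose time integral is
      -- finite.
      have hle : potential Q x {y | ε < f y}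
          ≤ ∫⁻ s in Ioi (0 : ℝ), (ENNReal.ofReal ε)⁻¹ * ENNReal.ofReal (u s - u (s + t)) := by
        refine setLIntegral_mono' measurableSet_Ioi fun s hs => ?_
        have := hQ.isProbabilityMeasure s.toNNReal x
        rw [← hus s (le_of_lt hs), ← hlint]
        have := mul_meas_ge_le_lintegral₀ (μ := Q s.toNNReal x)
          (hfm _).ennreal_ofReal (ENNReal.ofReal ε)
        rw [← ENNReal.div_eq_inv_mul, ENNReal.le_div_iff_mul_le (by simp [hε]) (by simp), mul_comm]
        refine le_trans ?_ this
        gcongr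
        rename_i y
        exact fun hy => ENNReal.ofReal_le_ofReal (le_of_lt hy)
      refine lt_of_le_of_lt hle ?_
      have hmeas : Measurable fun s => ENNReal.ofReal (u s - u (s + t)) :=
        (hua.measurable.sub (hua.measurable.comp (measurable_id.add_const _))).ennreal_ofReal
      rw [lintegral_const_mul _ hmeas]
      refine ENNReal.mul_lt_top (by simp [hε]) ?_
      exact hua.lintegral_sub_comp_add_lt_top (fun s => (hQ.integral_mem_Icc hg h0 h1 _ x).1)
        (fun s => (hQ.integral_mem_Icc hg h0 h1 _ x).2) t.2
    exact hlt.ne (h x)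
  have hmeas : Measurable fun s => ENNReal.ofReal (u s - u (s + t)) :=
    (hua.measurable.sub (hua.measurable.comp (measurable_id.add_const _))).ennreal_ofReal
  -- From `f ≤ 1_{f > ε} + ε`; a time interval of length one keeps the error at `ε`.
  have hzero : ∫⁻ s in Ioo (0 : ℝ) 1, ENNReal.ofReal (u s - u (s + t)) = 0 := by
    refine le_antisymm (ENNReal.le_of_forall_pos_le_add fun ε hε _ => ?_) zero_le
    have hεr : (0 : ℝ) < ε := hε
    calc ∫⁻ s in Ioo (0 : ℝ) 1, ENNReal.ofReal (u s - u (s + t))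
        ≤ ∫⁻ s in Ioo (0 : ℝ) 1, (Q s.toNNReal x {y | (ε : ℝ) < f y} + ε) := by
          refine setLIntegral_mono' measurableSet_Ioo fun s hs => ?_
          have := hQ.isProbabilityMeasure s.toNNReal x
          rw [← hus s (le_of_lt hs.1), ← hlint]
          calc ∫⁻ z, ENNReal.ofReal (f z) ∂Q s.toNNReal x
              ≤ ∫⁻ z, ({y | (ε : ℝ) < f y}.indicator 1 z + (ε : ℝ≥0∞)) ∂Q s.toNNReal x := by
                refine lintegral_mono fun z => ?_
                by_cases hz : (ε : ℝ) < f z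
                · have : z ∈ {y | (ε : ℝ) < f y} := hz
                  rw [indicator_of_mem this]
                  refine le_trans ?_ le_self_add
                  simpa using hf1 z
                · have : z ∉ {y | (ε : ℝ) < f y} := hz
                  rw [indicator_of_notMem this, zero_add]
                  refine ENNReal.ofReal_le_of_le_toReal ?_
                  simpa using hz
            _ = Q s.toNNReal x {y | (ε : ℝ) < f y} + ε := by
                rw [lintegral_add_right _ measurable_const,
                  lintegral_indicator_one₀ (hB ε hεr _ inferInstance)]
                simp
      _ = (∫⁻ s in Ioo (0 : ℝ) 1, Q s.toNNReal x {y | (ε : ℝ) < f y}) + ε := by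
          rw [lintegral_add_right _ measurable_const]; simp
      _ ≤ potential Q x {y | (ε : ℝ) < f y} + ε := by
          gcongr
          exact lintegral_mono_set Ioo_subset_Ioi_self
      _ = 0 + ε := by rw [hpot ε hεr]
  rw [lintegral_eq_zero_iff hmeas] at hzero
  filter_upwards [hzero, ae_restrict_mem measurableSet_Ioo] with s hs hmem
  rw [hus s hmem.1.le]
  refine le_antisymm ?_ (sub_nonneg.2 (hua (by linarith [t.2])))
  exact ENNReal.ofReal_eq_zero.1 hs

/-- A strictly positive function with `Q_t h = e^{-αt} h`, `α ≥ 0`, is constant, and `α = 0`, if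
the transition function is recurrent. -/
theorem eigenfunction_const [Nonempty E] (hQ : IsUniversalTransition Q)
    (hrec : IsRecurrentTransition Q) {h : E → ℝ} (hm : Measurable h) (hpos : ∀ x, 0 < h x)
    (hint : ∀ t x, Integrable h (Q t x)) {α : ℝ} (hα : 0 ≤ α)
    (heig : ∀ t x, ∫ z, h z ∂Q t x = Real.exp (-α * t) * h x) :
    α = 0 ∧ ∃ a : ℝ, 0 < a ∧ ∀ x, h x = a := by
  have := hQ.isProbabilityMeasure
  set g : E → ℝ := fun x => h x / (1 + h x) with hgdef
  have hg : Measurable g := by fun_prop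
  have h0 : ∀ x, 0 ≤ g x := fun x => div_nonneg (hpos x).le (by linarith [hpos x])
  have h1 : ∀ x, g x ≤ 1 := fun x => by
    simp only [hgdef]; rw [div_le_one (by linarith [hpos x])]; linarith
  have hle : ∀ t x, ∫ z, h z ∂Q t x ≤ h x := by
    intro t x
    rw [heig]
    refine mul_le_of_le_one_left (hpos x).le (Real.exp_le_one_iff.2 ?_)
    have : 0 ≤ α * (t : ℝ) := mul_nonneg hα t.2
    linarith
  have hsup : ∀ t x, ∫ z, g z ∂Q t x ≤ g x := fun t x =>
    integral_div_one_add_le hm hpos (hint t x) (hpos x) (hle t x)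
  have hgi : ∀ t x, Integrable g (Q t x) := fun t x => integrable_div_one_add hm hpos
  -- With only countably many times `n`, a single `s` and then a single `y` avoid all the
  -- exceptional null sets.
  obtain ⟨y, hy⟩ : ∃ y, ∀ n : ℕ, ∫ z, g z ∂Q (n : ℝ≥0) y = g y := by
    obtain ⟨x⟩ := ‹Nonempty E›
    have hae := ae_all_iff.2 fun n : ℕ => hQ.ae_integral_add_eq hrec hg h0 h1 hsup (n : ℝ≥0) x
    have hne : (ae (volume.restrict (Ioo (0 : ℝ) 1))).NeBot := by
      rw [ae_neBot]
      intro h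
      have := congrArg (fun μ => μ univ) h
      simp at this
    obtain ⟨s, hs⟩ := hae.exists
    have hz : ∀ n : ℕ, ∀ᵐ y ∂Q s.toNNReal x, g y - ∫ z, g z ∂Q (n : ℝ≥0) y = 0 := by
      intro n
      have hi : Integrable (fun y => ∫ z, g z ∂Q (n : ℝ≥0) y) (Q s.toNNReal x) :=
        integrable_of_measurable_of_mem_Icc
          (hQ.aemeasurable_integral hg h0 n _).aestronglyMeasurable
          (fun y => (hQ.integral_mem_Icc hg h0 h1 n y).1)
          (fun y => (hQ.integral_mem_Icc hg h0 h1 n y).2)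
      have hz := hs n
      rw [← hQ.integral_integral hg h0 h1, ← integral_sub (hgi _ _) hi,
        integral_eq_zero_iff_of_nonneg (fun y => sub_nonneg.2 (hsup _ y)) ((hgi _ _).sub hi)] at hz
      exact hz
    obtain ⟨y, hy⟩ := (ae_all_iff.2 hz).exists
    exact ⟨y, fun n => (sub_eq_zero.1 (hy n)).symm⟩
  -- Monotonicity in time squeezes real times between `0` and an integer.
  have hyt : ∀ t, ∫ z, g z ∂Q t y = g y := by
    intro t
    obtain ⟨n, hn⟩ := exists_nat_ge t
    refine le_antisymm (hsup t y) ?_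
    rw [← hy n]
    exact hQ.antitone_integral hg h0 h1 hsup y hn
  have hyeq := fun t => eq_of_integral_div_one_add_eq hm hpos (hint t y) (hpos y) (hle t y) (hyt t)
  have hα0 : α = 0 := by
    have := (hyeq 1).1
    rw [heig, mul_eq_right₀ (hpos y).ne', Real.exp_eq_one_iff] at this
    simpa using this
  refine ⟨hα0, h y, hpos y, ?_⟩
  set B : Set E := {z | h z ≠ h y} with hBdef
  have hBm : MeasurableSet B := (hm (measurableSet_singleton (h y))).compl
  have hB : ∀ x, potential Q x B = 0 := by
    -- From `y` the process never charges `B`, which rules out infinite potential.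
    refine (hrec B fun μ _ => hBm.nullMeasurableSet).resolve_right fun hinf => ?_
    have hzero : potential Q y B = 0 := by
      have : ∀ t, Q t y B = 0 := fun t => (hyeq t).2
      simp [potential, this]
    exact ENNReal.zero_ne_top (hzero.symm.trans (hinf y))
  have hconst : ∀ x, ∃ t, ∫ z, g z ∂Q t x = g y := by
    intro x
    set u : ℝ → ℝ := fun s => ∫ z, g z ∂Q s.toNNReal x with hu
    have hua : Antitone u := fun a b hab =>
      hQ.antitone_integral hg h0 h1 hsup x (Real.toNNReal_le_toNNReal hab)
    have hum : Measurable fun s => ENNReal.ofReal |u s - g y| := by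
      have := hua.measurable
      fun_prop
    -- `|g - g y| ≤ 1_B`, since `g` takes values in `[0, 1]` and equals `g y` off `B`.
    have hzero : ∫⁻ s in Ioi (0 : ℝ), ENNReal.ofReal |u s - g y| = 0 := by
      refine le_antisymm (le_trans (lintegral_mono fun s => ?_) (hB x).le) zero_le
      have e : u s - g y = ∫ z, (g z - g y) ∂Q s.toNNReal x := by
        rw [integral_sub (hgi _ _) (integrable_const _)]; simp [hu]
      calc ENNReal.ofReal |u s - g y|
          ≤ ENNReal.ofReal (∫ z, B.indicator 1 z ∂Q s.toNNReal x) := by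
            refine ENNReal.ofReal_le_ofReal ?_
            rw [e]
            refine (abs_integral_le_integral_abs).trans (integral_mono ?_ ?_ fun z => ?_)
            · exact ((hgi _ _).sub (integrable_const _)).abs
            · exact (integrable_const (1 : ℝ)).indicator hBm
            · by_cases hz : z ∈ B
              · simp only [indicator_of_mem hz, Pi.one_apply, abs_le]
                constructor <;> linarith [h0 z, h1 z, h0 y, h1 y]
              · have : h z = h y := not_not.1 hz
                simp [indicator_of_notMem hz, hgdef, this]
        _ = Q s.toNNReal x B := by
            rw [integral_indicator_one hBm]; simp [Measure.real]
    rw [lintegral_eq_zero_iff hum] at hzero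
    have hne : (ae (volume.restrict (Ioi (0 : ℝ)))).NeBot := by
      rw [ae_neBot]
      intro h
      have := congrArg (fun μ => μ univ) h
      simp at this
    obtain ⟨s, hs⟩ := hzero.exists
    refine ⟨s.toNNReal, ?_⟩
    have := ENNReal.ofReal_eq_zero.1 hs
    exact sub_eq_zero.1 (abs_eq_zero.1 (le_antisymm this (abs_nonneg _)))
  -- So `g y` is the minimum of `g`; a mean equal to the minimum makes `g`, hence `h`, almost surely
  -- constant under `Q t x`.
  have hge : ∀ x, g y ≤ g x := fun x => by
    obtain ⟨t, ht⟩ := hconst x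
    exact ht ▸ hsup t x
  have hinj : ∀ x, g x = g y → h x = h y := by
    intro x hx
    simp only [hgdef] at hx
    rw [div_eq_div_iff (by linarith [hpos x]) (by linarith [hpos y])] at hx
    linarith
  intro x
  obtain ⟨t, ht⟩ := hconst x
  have hae : ∀ᵐ z ∂Q t x, g z - g y = 0 := by
    have : ∫ z, (g z - g y) ∂Q t x = 0 := by
      rw [integral_sub (hgi _ _) (integrable_const _), ht]; simp
    rwa [integral_eq_zero_iff_of_nonneg (fun z => sub_nonneg.2 (hge z))
      ((hgi _ _).sub (integrable_const _))] at this
  have hxt := heig t x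
  rw [integral_congr_ae (g := fun _ => h y)
    (hae.mono fun z hz => hinj z (sub_eq_zero.1 hz)), hα0] at hxt
  simpa using hxt.symm

end IsUniversalTransition

/-! ### Measurability up to null sets -/

/-- A function measurable up to null sets has a measurable version. -/
theorem exists_measurable_ae_eq_of_eventuallyMeasurable {Ω : Type*} {m m0 : MeasurableSpace Ω}
    {μ : Measure[m0] Ω} {F : Ω → ℝ≥0∞}
    (hF : Measurable[eventuallyMeasurableSpace m (ae μ)] F) :
    ∃ F' : Ω → ℝ≥0∞, Measurable[m] F' ∧ F =ᵐ[μ] F' := by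
  refine Measurable.ennreal_induction (mα := eventuallyMeasurableSpace m (ae μ))
    (motive := fun F => ∃ F' : Ω → ℝ≥0∞, Measurable[m] F' ∧ F =ᵐ[μ] F') ?_ ?_ ?_ hF
  · rintro c s ⟨t, ht, hst⟩
    exact ⟨t.indicator fun _ => c, measurable_const.indicator ht,
      indicator_ae_eq_of_ae_eq_set hst⟩
  · rintro f g - - - ⟨f', hf', hff'⟩ ⟨g', hg', hgg'⟩
    exact ⟨f' + g', hf'.add hg', hff'.add hgg'⟩
  · intro f _ _ hf
    choose f' hf' hff' using hf
    refine ⟨fun x => ⨆ n, f' n x, Measurable.iSup hf', ?_⟩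
    filter_upwards [ae_all_iff.2 hff'] with x hx
    simp [hx]

/-- Two functions with equal integrals over all sets of a sub-σ-algebra `m` have equal integrals
against all `m`-measurable functions. -/
theorem lintegral_mul_congr_of_setLIntegral {Ω : Type*} {m m0 : MeasurableSpace Ω}
    {μ : Measure[m0] Ω} (hm : m ≤ m0) {F G Z : Ω → ℝ≥0∞} (hF : Measurable[m0] F)
    (hG : Measurable[m0] G)
    (hFG : ∀ A, MeasurableSet[m] A → ∫⁻ ω in A, F ω ∂μ = ∫⁻ ω in A, G ω ∂μ)
    (hZ : Measurable[m] Z) : ∫⁻ ω, Z ω * F ω ∂μ = ∫⁻ ω, Z ω * G ω ∂μ := by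
  have heq : (μ.withDensity F).trim hm = (μ.withDensity G).trim hm := by
    refine @Measure.ext _ m _ _ fun A hA => ?_
    rw [trim_measurableSet_eq hm hA, trim_measurableSet_eq hm hA, withDensity_apply _ (hm A hA),
      withDensity_apply _ (hm A hA), hFG A hA]
  have h := lintegral_trim (μ := μ.withDensity F) hm hZ
  rw [heq, lintegral_trim hm hZ,
    lintegral_withDensity_eq_lintegral_mul _ hG (hZ.mono hm le_rfl),
    lintegral_withDensity_eq_lintegral_mul _ hF (hZ.mono hm le_rfl)] at h
  simpa [mul_comm] using h.symm

namespace BorelRightProcess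

variable {E Ω : Type*} [TopologicalSpace E] [MeasurableSpace E] [BorelSpace E] [LusinSpace E]
  [mΩ : MeasurableSpace Ω] (𝕏 : BorelRightProcess E Ω)

instance isMarkovKernel_P : IsMarkovKernel 𝕏.P := 𝕏.isMarkovKernel

theorem measurable_X (t : ℝ≥0) : Measurable (𝕏.X t) := by
  rw [measurable_iff_comap_le]
  conv_rhs => rw [𝕏.generates]
  exact le_iSup (fun u => MeasurableSpace.comap (𝕏.X u) inferInstance) t

theorem comap_X_le_rawSigma {s t : ℝ≥0} (hst : s ≤ t) :
    MeasurableSpace.comap (𝕏.X s) inferInstance ≤ 𝕏.rawSigma t :=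
  le_iSup₂ (f := fun (u : ℝ≥0) (_ : u ≤ t) => MeasurableSpace.comap (𝕏.X u) inferInstance) s hst

theorem measurable_shift (s : ℝ≥0) : Measurable (𝕏.θ s) := by
  rw [measurable_iff_comap_le]
  refine (MeasurableSpace.comap_mono 𝕏.generates.le).trans ?_
  rw [MeasurableSpace.comap_iSup]
  refine iSup_le fun u => ?_
  rw [MeasurableSpace.comap_comp]
  have : 𝕏.X u ∘ 𝕏.θ s = 𝕏.X (u + s) := funext fun ω => 𝕏.shift s u ω
  rw [this]
  exact (𝕏.measurable_X _).comap_le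

theorem measurable_shift_rawSigma (s t : ℝ≥0) :
    Measurable[𝕏.rawSigma (s + t), 𝕏.rawSigma t] (𝕏.θ s) := by
  rw [measurable_iff_comap_le, rawSigma]
  simp only [MeasurableSpace.comap_iSup]
  refine iSup₂_le fun u hu => ?_
  rw [MeasurableSpace.comap_comp]
  have : 𝕏.X u ∘ 𝕏.θ s = 𝕏.X (u + s) := funext fun ω => 𝕏.shift s u ω
  rw [this]
  exact 𝕏.comap_X_le_rawSigma (by rw [add_comm]; gcongr)

/-! ### The Markov property -/

/-- The simple Markov property of a process `X`, in terms of the one-dimensional distributions. -/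
def HasMarkovProperty (𝓜 : Filtration ℝ≥0 mΩ) : Prop :=
  ∀ x s (A : Set Ω), MeasurableSet[𝓜 s] A → ∀ r (B : Set E), MeasurableSet B →
    𝕏.P x (A ∩ 𝕏.X (s + r) ⁻¹' B) = ∫⁻ ω in A, 𝕏.P (𝕏.X s ω) (𝕏.X r ⁻¹' B) ∂𝕏.P x

/-- Constant stopping times and point masses as initial laws suffice. Of the given filtration only
the inclusion of the raw σ-algebras is retained. -/
theorem exists_hasMarkovProperty :
    ∃ 𝓜 : Filtration ℝ≥0 mΩ, (∀ t, 𝕏.rawSigma t ≤ 𝓜 t) ∧ 𝕏.HasMarkovProperty 𝓜 := by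
  obtain ⟨𝓜, -, hadapt, hstrong⟩ := 𝕏.strong_markov
  refine ⟨𝓜, fun t => iSup₂_le fun s hs => (hadapt s).comap_le.trans (𝓜.mono hs), ?_⟩
  intro x s A hA r B hB
  have h := hstrong _ (isStoppingTime_const 𝓜 s) (Measure.dirac x) inferInstance r B hB
  rw [Measure.dirac_bind 𝕏.P.measurable x] at h
  have hlt : (s : WithTop ℝ≥0) < ⊤ := WithTop.coe_lt_top s
  have hu : (s : WithTop ℝ≥0).untopA = s := rfl
  have hset : {ω : Ω | ((s : WithTop ℝ≥0)) < ⊤ ∧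
      𝕏.X ((s : WithTop ℝ≥0).untopA + r) ω ∈ B} = 𝕏.X (s + r) ⁻¹' B := by
    ext ω
    exact ⟨fun h => h.2, fun h => ⟨hlt, h⟩⟩
  have huniv : {ω : Ω | (s : WithTop ℝ≥0) < ⊤} = univ :=
    eq_univ_of_forall fun _ => hlt
  rw [hset, huniv, Measure.restrict_univ] at h
  simp only [hu, IsStoppingTime.measurableSpace_const] at h
  have hm := 𝓜.le s
  have hBm : MeasurableSet (𝕏.X (s + r) ⁻¹' B) := 𝕏.measurable_X _ hB
  have hint : Integrable ((𝕏.X (s + r) ⁻¹' B).indicator fun _ => (1 : ℝ)) (𝕏.P x) :=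
    (integrable_const _).indicator hBm
  have h1 := setIntegral_condExp hm hint hA
  rw [setIntegral_congr_ae (g := fun ω => (𝕏.P (𝕏.X s ω)).real {ω' | 𝕏.X r ω' ∈ B}) (hm A hA)
    (h.mono fun ω hω _ => hω)] at h1
  have hK : Measurable fun ω => 𝕏.P (𝕏.X s ω) (𝕏.X r ⁻¹' B) :=
    (𝕏.P.measurable_coe (𝕏.measurable_X r hB)).comp (𝕏.measurable_X s)
  have h2 : ∫ ω in A, (𝕏.P (𝕏.X s ω)).real {ω' | 𝕏.X r ω' ∈ B} ∂𝕏.P x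
      = (∫⁻ ω in A, 𝕏.P (𝕏.X s ω) (𝕏.X r ⁻¹' B) ∂𝕏.P x).toReal :=
    integral_toReal hK.aemeasurable (Eventually.of_forall fun ω => measure_lt_top _ _)
  have h3 : ∫ ω in A, (𝕏.X (s + r) ⁻¹' B).indicator (fun _ => (1 : ℝ)) ω ∂𝕏.P x
      = (𝕏.P x (A ∩ 𝕏.X (s + r) ⁻¹' B)).toReal := by
    rw [setIntegral_indicator hBm]
    simp [Measure.real]
  rw [h2, h3] at h1
  refine ((ENNReal.toReal_eq_toReal_iff' ?_ (measure_ne_top _ _)).1 h1).symm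
  refine (lt_of_le_of_lt (lintegral_mono (g := fun _ => 1) fun ω => prob_le_one) ?_).ne
  simp

variable {𝕏} {𝓜 : Filtration ℝ≥0 mΩ}

theorem HasMarkovProperty.setLIntegral (hM : 𝕏.HasMarkovProperty 𝓜) (x : E) (s r : ℝ≥0)
    {A : Set Ω} (hA : MeasurableSet[𝓜 s] A) {f : E → ℝ≥0∞} (hf : Measurable f) :
    ∫⁻ ω in A, f (𝕏.X (s + r) ω) ∂𝕏.P x
      = ∫⁻ ω in A, ∫⁻ ω', f (𝕏.X r ω') ∂𝕏.P (𝕏.X s ω) ∂𝕏.P x := by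
  have hker : Measurable fun ω => (𝕏.P (𝕏.X s ω)).map (𝕏.X r) :=
    (Measure.measurable_map _ (𝕏.measurable_X r)).comp
      (𝕏.P.measurable.comp (𝕏.measurable_X s))
  have heq : ((𝕏.P x).restrict A).map (𝕏.X (s + r))
      = ((𝕏.P x).restrict A).bind fun ω => (𝕏.P (𝕏.X s ω)).map (𝕏.X r) := by
    ext B hB
    rw [Measure.map_apply (𝕏.measurable_X _) hB, Measure.bind_apply hB hker.aemeasurable,
      Measure.restrict_apply (𝕏.measurable_X _ hB), inter_comm, hM x s A hA r B hB]
    simp only [Measure.map_apply (𝕏.measurable_X r) hB]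
  rw [← lintegral_map hf (𝕏.measurable_X _), heq,
    Measure.lintegral_bind hker.aemeasurable hf.aemeasurable]
  simp only [lintegral_map hf (𝕏.measurable_X r)]

/-- Induction on the finite set of times, adding the largest one last. Carrying a function `f` of
the state at a later time `t` makes the induction close. -/
theorem HasMarkovProperty.setLIntegral_cylinder (hM : 𝕏.HasMarkovProperty 𝓜)
    (hle : ∀ t, 𝕏.rawSigma t ≤ 𝓜 t) (S : Finset ℝ≥0) (C : ℝ≥0 → Set Ω)
    (hC : ∀ u ∈ S, MeasurableSet[MeasurableSpace.comap (𝕏.X u) inferInstance] (C u)) :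
    ∀ t, (∀ u ∈ S, u ≤ t) → ∀ x s (A : Set Ω), MeasurableSet[𝓜 s] A →
      ∀ f : E → ℝ≥0∞, Measurable f →
      ∫⁻ ω in A ∩ 𝕏.θ s ⁻¹' (⋂ u ∈ S, C u), f (𝕏.X (s + t) ω) ∂𝕏.P x
        = ∫⁻ ω in A, ∫⁻ ω' in ⋂ u ∈ S, C u, f (𝕏.X t ω') ∂𝕏.P (𝕏.X s ω) ∂𝕏.P x := by
  induction S using Finset.induction_on_max with
  | empty =>
    intro t _ x s A hA f hf
    simpa using hM.setLIntegral x s t hA hf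
  | insert a S hmax ih =>
    have hCS : ∀ u ∈ S, MeasurableSet[MeasurableSpace.comap (𝕏.X u) inferInstance] (C u) :=
      fun u hu => hC u (Finset.mem_insert_of_mem hu)
    obtain ⟨B, hB, hBC⟩ := hC a (Finset.mem_insert_self a S)
    have hD : MeasurableSet[𝕏.rawSigma a] (⋂ u ∈ insert a S, C u) := by
      refine MeasurableSet.biInter (Finset.countable_toSet _) fun u hu => ?_
      have hua : u ≤ a := by
        rcases Finset.mem_insert.1 hu with rfl | hu
        · exact le_rfl
        · exact (hmax u hu).le
      exact 𝕏.comap_X_le_rawSigma hua _ (hC u hu)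
    have hDeq : (⋂ u ∈ insert a S, C u) = (⋂ u ∈ S, C u) ∩ 𝕏.X a ⁻¹' B := by
      rw [Finset.set_biInter_insert, inter_comm, hBC]
    set D := ⋂ u ∈ insert a S, C u with hDdef
    -- At `t = a` the new constraint `X_a ∈ B` is absorbed into the terminal function as `1_B f`.
    have hsa : ∀ x s (A : Set Ω), MeasurableSet[𝓜 s] A → ∀ f : E → ℝ≥0∞, Measurable f →
        ∫⁻ ω in A ∩ 𝕏.θ s ⁻¹' D, f (𝕏.X (s + a) ω) ∂𝕏.P x
          = ∫⁻ ω in A, ∫⁻ ω' in D, f (𝕏.X a ω') ∂𝕏.P (𝕏.X s ω) ∂𝕏.P x := by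
      intro x s A hA f hf
      have h := ih hCS a (fun u hu => (hmax u hu).le) x s A hA _ (hf.indicator hB)
      have e1 : ∀ (ν : Measure Ω) (G : Set Ω) (r : ℝ≥0),
          ∫⁻ ω in G, B.indicator f (𝕏.X r ω) ∂ν = ∫⁻ ω in G ∩ 𝕏.X r ⁻¹' B, f (𝕏.X r ω) ∂ν := by
        intro ν G r
        rw [inter_comm, ← setLIntegral_indicator (𝕏.measurable_X r hB)]
        rfl
      rw [e1] at h
      simp only [e1] at h
      rw [hDeq]
      convert h using 3
      rw [preimage_inter, ← inter_assoc]
      congr 1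
      ext ω
      simp [𝕏.shift, add_comm]
    intro t ht x s A hA f hf
    obtain ⟨r, rfl⟩ := exists_add_of_le (ht a (Finset.mem_insert_self a S))
    have hA' : MeasurableSet[𝓜 (s + a)] (A ∩ 𝕏.θ s ⁻¹' D) :=
      (𝓜.mono le_self_add A hA).inter (hle _ _ (𝕏.measurable_shift_rawSigma s a hD))
    have hK : Measurable fun y => ∫⁻ ω', f (𝕏.X r ω') ∂𝕏.P y :=
      (hf.comp (𝕏.measurable_X r)).lintegral_kernel
    -- For `t = a + r`, condition at `s + a`, use the case `t = a`, and undo the conditioning under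
    -- `P_{X_s}`.
    rw [← add_assoc, hM.setLIntegral x (s + a) r hA' hf, hsa x s A hA _ hK]
    refine lintegral_congr fun ω => ?_
    rw [hM.setLIntegral (𝕏.X s ω) a r (hle a _ hD) hf]

/-- The Markov property for sets in `σ(X_s, s ≥ 0)`. -/
theorem HasMarkovProperty.map_shift (hM : 𝕏.HasMarkovProperty 𝓜)
    (hle : ∀ t, 𝕏.rawSigma t ≤ 𝓜 t) (x : E) (s : ℝ≥0) {A : Set Ω} (hA : MeasurableSet[𝓜 s] A) :
    ((𝕏.P x).restrict A).map (𝕏.θ s) = ((𝕏.P x).restrict A).bind fun ω => 𝕏.P (𝕏.X s ω) := by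
  have hker : Measurable fun ω => 𝕏.P (𝕏.X s ω) := 𝕏.P.measurable.comp (𝕏.measurable_X s)
  have hcyl := fun S C hC => hM.setLIntegral_cylinder hle S C hC
  -- Finite-dimensional cylinders form a π-system generating the σ-algebra of `Ω`.
  refine ext_of_generate_finite
    (piiUnionInter (fun t => {B | MeasurableSet[MeasurableSpace.comap (𝕏.X t) inferInstance] B})
      univ) ?_ ?_ ?_ ?_
  · have h := generateFrom_piiUnionInter_measurableSet
      (fun t => MeasurableSpace.comap (𝕏.X t) inferInstance) univ
    refine Eq.trans ?_ h.symm
    simpa using 𝕏.generates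
  · exact isPiSystem_piiUnionInter _
      (fun t => @MeasurableSpace.isPiSystem_measurableSet _ (MeasurableSpace.comap (𝕏.X t) _)) _
  · rintro _ ⟨S, -, C, hC, rfl⟩
    have hmeas : MeasurableSet (⋂ u ∈ S, C u) :=
      MeasurableSet.biInter (Finset.countable_toSet _) fun u hu =>
        (𝕏.measurable_X u).comap_le _ (hC u hu)
    have h := hcyl S C hC (S.sup id) (fun u hu => Finset.le_sup (f := id) hu) x s A hA
      (fun _ => 1) measurable_const
    rw [Measure.map_apply (𝕏.measurable_shift s) hmeas,
      Measure.bind_apply hmeas hker.aemeasurable,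
      Measure.restrict_apply (𝕏.measurable_shift s hmeas), inter_comm]
    simpa using h
  · rw [Measure.map_apply (𝕏.measurable_shift s) MeasurableSet.univ,
      Measure.bind_apply MeasurableSet.univ hker.aemeasurable]
    simp

variable (𝕏)

theorem lintegral_mul_comp_shift_of_rawSigma (x : E) (s : ℝ≥0) {Z F : Ω → ℝ≥0∞}
    (hZ : Measurable[𝕏.rawSigma s] Z) (hF : Measurable F) :
    ∫⁻ ω, Z ω * F (𝕏.θ s ω) ∂𝕏.P x
      = ∫⁻ ω, Z ω * ∫⁻ ω', F ω' ∂𝕏.P (𝕏.X s ω) ∂𝕏.P x := by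
  obtain ⟨𝓜, hle, hM⟩ := 𝕏.exists_hasMarkovProperty
  have hker : Measurable fun ω => 𝕏.P (𝕏.X s ω) := 𝕏.P.measurable.comp (𝕏.measurable_X s)
  refine lintegral_mul_congr_of_setLIntegral (𝓜.le s) (hF.comp (𝕏.measurable_shift s))
    (hF.lintegral_kernel.comp (𝕏.measurable_X s)) (fun A hA => ?_) (hZ.mono (hle s) le_rfl)
  have h := hM.map_shift hle x s hA
  rw [← lintegral_map hF (𝕏.measurable_shift s), h,
    Measure.lintegral_bind hker.aemeasurable hF.aemeasurable]

/-! ### Extension to the universal completion -/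

/-- Trimming could enlarge the outer measure, but a hull measurable for the original σ-algebra is
also measurable for the completion. -/
theorem prob_apply (x : E) (N : Set Ω) : 𝕏.prob x N = 𝕏.P x N := by
  have hle : mΩ ≤ 𝕏.sigmaInf := le_iInf₂ fun _ _ => le_eventuallyMeasurableSpace
  refine le_antisymm ?_ ?_
  · obtain ⟨B, hNB, hB, hBeq⟩ := exists_measurable_superset (𝕏.P x) N
    rw [← hBeq]
    refine (measure_mono hNB).trans ?_
    exact ((trim_measurableSet_eq (𝕏.sigmaInf_le x) (hle B hB)).trans
      (Measure.completion_apply _ _)).le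
  · have := le_trim (μ := (𝕏.P x).completion) (s := N) (𝕏.sigmaInf_le x)
    rwa [Measure.completion_apply] at this

theorem ae_prob (x : E) : ae (𝕏.prob x) = ae (𝕏.P x) := by
  ext N
  rw [mem_ae_iff, mem_ae_iff, prob_apply]

theorem exists_measurable_version (μ : Measure E) [IsProbabilityMeasure μ] {F : Ω → ℝ≥0∞}
    (hF : Measurable[𝕏.sigmaInf] F) :
    ∃ F' : Ω → ℝ≥0∞, Measurable F' ∧ F =ᵐ[𝕏.initialLaw μ] F' :=
  exists_measurable_ae_eq_of_eventuallyMeasurable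
    (hF.mono (iInf₂_le μ ‹_›) le_rfl)

theorem initialLaw_dirac (x : E) : 𝕏.initialLaw (Measure.dirac x) = 𝕏.P x :=
  Measure.dirac_bind 𝕏.P.measurable x

theorem exists_measurable_version_rawSigma (x : E) (t : ℝ≥0) {F : Ω → ℝ≥0∞}
    (hF : Measurable[𝕏.sigmaAt t] F) :
    ∃ F' : Ω → ℝ≥0∞, Measurable[𝕏.rawSigma t] F' ∧ F =ᵐ[𝕏.P x] F' := by
  rw [← initialLaw_dirac]
  exact exists_measurable_ae_eq_of_eventuallyMeasurable
    (hF.mono (iInf₂_le (Measure.dirac x) Measure.dirac.isProbabilityMeasure) le_rfl)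

theorem lintegral_prob (x : E) {F : Ω → ℝ≥0∞} (hF : Measurable[𝕏.sigmaInf] F) :
    ∫⁻ ω, F ω ∂𝕏.prob x = ∫⁻ ω, F ω ∂𝕏.P x := by
  obtain ⟨F', hF', hFF'⟩ := 𝕏.exists_measurable_version (Measure.dirac x) hF
  rw [initialLaw_dirac] at hFF'
  have hle : mΩ ≤ 𝕏.sigmaInf := le_iInf₂ fun _ _ => le_eventuallyMeasurableSpace
  have htrim : (𝕏.prob x).trim hle = 𝕏.P x := by
    ext B hB
    rw [trim_measurableSet_eq hle hB, prob_apply]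
  have hFF'' : F =ᵐ[𝕏.prob x] F' := by
    rw [Filter.EventuallyEq, ae_prob]; exact hFF'
  rw [lintegral_congr_ae hFF'', lintegral_congr_ae hFF', ← lintegral_trim hle hF', htrim]

/-- A `P_μ`-null set is `P_y`-null for `μ`-almost every `y`. -/
theorem ae_lintegral_version_eq (μ : Measure E) {F F' : Ω → ℝ≥0∞}
    (hFF' : F =ᵐ[𝕏.initialLaw μ] F') :
    (fun y => ∫⁻ ω, F ω ∂𝕏.P y) =ᵐ[μ] fun y => ∫⁻ ω, F' ω ∂𝕏.P y := by
  filter_upwards [Measure.ae_ae_of_ae_bind 𝕏.P.measurable.aemeasurable hFF'] with y hy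
  exact lintegral_congr_ae hy

theorem aemeasurable_lintegral (μ : Measure E) [IsFiniteMeasure μ] {F : Ω → ℝ≥0∞}
    (hF : Measurable[𝕏.sigmaInf] F) : AEMeasurable (fun y => ∫⁻ ω, F ω ∂𝕏.P y) μ := by
  rcases eq_or_ne μ 0 with rfl | hμ
  · exact aemeasurable_zero_measure
  have : NeZero μ := ⟨hμ⟩
  -- The completion is defined through probability measures, so `μ` is normalised first; the null
  -- sets are the same.
  have hpr : IsProbabilityMeasure ((μ univ)⁻¹ • μ) := isProbabilityMeasureSMul
  obtain ⟨F', hF', hFF'⟩ := 𝕏.exists_measurable_version ((μ univ)⁻¹ • μ) hF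
  refine ⟨fun y => ∫⁻ ω, F' ω ∂𝕏.P y, hF'.lintegral_kernel, ?_⟩
  exact (Measure.absolutelyContinuous_smul (by simp)) (𝕏.ae_lintegral_version_eq _ hFF')

/-- Through this identity, versions under the initial law of `X_s` remain versions after composition
with `θ_s`. -/
theorem map_shift (x : E) (s : ℝ≥0) :
    (𝕏.P x).map (𝕏.θ s) = 𝕏.initialLaw ((𝕏.P x).map (𝕏.X s)) := by
  obtain ⟨𝓜, hle, hM⟩ := 𝕏.exists_hasMarkovProperty
  have h := hM.map_shift hle x s MeasurableSet.univ
  rw [Measure.restrict_univ] at h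
  have hker : Measurable fun ω => 𝕏.P (𝕏.X s ω) := 𝕏.P.measurable.comp (𝕏.measurable_X s)
  rw [h, initialLaw]
  ext B hB
  rw [Measure.bind_apply hB hker.aemeasurable,
    Measure.bind_apply hB 𝕏.P.measurable.aemeasurable,
    lintegral_map (𝕏.P.measurable_coe hB) (𝕏.measurable_X s)]

/-- The Markov property relative to the minimum augmented filtration. -/
theorem lintegral_mul_comp_shift (x : E) (s : ℝ≥0) {Z F : Ω → ℝ≥0∞}
    (hZ : Measurable[𝕏.sigmaAt s] Z) (hF : Measurable[𝕏.sigmaInf] F) :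
    ∫⁻ ω, Z ω * F (𝕏.θ s ω) ∂𝕏.P x
      = ∫⁻ ω, Z ω * ∫⁻ ω', F ω' ∂𝕏.P (𝕏.X s ω) ∂𝕏.P x := by
  have : IsProbabilityMeasure ((𝕏.P x).map (𝕏.X s)) :=
    Measure.isProbabilityMeasure_map (𝕏.measurable_X s).aemeasurable
  obtain ⟨Z', hZ', hZZ'⟩ := 𝕏.exists_measurable_version_rawSigma x s hZ
  -- `F` is evaluated on the shifted path, so its version is taken for the law of `X_s` as initial
  -- distribution.
  obtain ⟨F', hF', hFF'⟩ := 𝕏.exists_measurable_version ((𝕏.P x).map (𝕏.X s)) hF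
  have h1 := ae_of_ae_map (𝕏.measurable_X s).aemeasurable (𝕏.ae_lintegral_version_eq _ hFF')
  rw [← map_shift] at hFF'
  have h2 := ae_of_ae_map (𝕏.measurable_shift s).aemeasurable hFF'
  have h := 𝕏.lintegral_mul_comp_shift_of_rawSigma x s hZ' hF'
  rw [lintegral_congr_ae (g := fun ω => Z' ω * F' (𝕏.θ s ω)), h]
  · refine lintegral_congr_ae ?_
    filter_upwards [hZZ', h1] with ω h3 h4
    rw [h3, h4]
  · filter_upwards [hZZ', h2] with ω h3 h4
    rw [h3, h4]

end BorelRightProcess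

namespace BorelRightProcess

variable {E Ω : Type*} [TopologicalSpace E] [MeasurableSpace E] [BorelSpace E] [LusinSpace E]
  [mΩ : MeasurableSpace Ω] {𝕏 : BorelRightProcess E Ω}

/-! ### The transition function under the eigen-measures -/

theorem le_sigmaInf : mΩ ≤ 𝕏.sigmaInf := le_iInf₂ fun _ _ => le_eventuallyMeasurableSpace

theorem rawSigma_le_sigmaAt (t : ℝ≥0) : 𝕏.rawSigma t ≤ 𝕏.sigmaAt t :=
  le_iInf₂ fun _ _ => le_eventuallyMeasurableSpace

theorem sigmaAt_le_sigmaInf (t : ℝ≥0) : 𝕏.sigmaAt t ≤ 𝕏.sigmaInf := 𝕏.filtration.le t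

theorem measurable_X_sigmaAt (t : ℝ≥0) : Measurable[𝕏.sigmaAt t] (𝕏.X t) := by
  rw [measurable_iff_comap_le]
  exact (𝕏.comap_X_le_rawSigma le_rfl).trans (rawSigma_le_sigmaAt t)

variable {S : ℝ≥0 → Ω → ℝ} {lam : ℝ} {π : E → ℝ} {M : ℝ≥0 → Ω → ℝ}

theorem IsPricingKernel.measurable_sigmaAt [Nonempty E] (hS : 𝕏.IsPricingKernel S) (t : ℝ≥0) :
    Measurable[𝕏.sigmaAt t] (S t) :=
  ((hS.semimartingale (Classical.arbitrary E)).adapted t).measurable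

theorem IsPricingKernel.measurable_payoff [Nonempty E] (hS : 𝕏.IsPricingKernel S) (t : ℝ≥0)
    {f : E → ℝ≥0∞} (hf : Measurable f) :
    Measurable[𝕏.sigmaAt t] fun ω => ENNReal.ofReal (S t ω) * f (𝕏.X t ω) :=
  (hS.measurable_sigmaAt t).ennreal_ofReal.mul (hf.comp (measurable_X_sigmaAt t))

/-- A non-integrable payoff would have integral `0` by convention, whereas the eigenvalue equation
gives a positive value. -/
theorem IsPositiveEigenfunction.integrable
    (hπ : 𝕏.IsPositiveEigenfunction S lam π) (t : ℝ≥0) (x : E) :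
    Integrable (fun ω => S t ω * π (𝕏.X t ω)) (𝕏.prob x) := by
  by_contra h
  have h1 := hπ.eigen t x
  rw [pricingOp, integral_undef h] at h1
  have := mul_pos (Real.exp_pos (-lam * t)) (hπ.pos x)
  linarith

theorem IsPositiveEigenfunction.lintegral_eq [Nonempty E] (hS : 𝕏.IsPricingKernel S)
    (hπ : 𝕏.IsPositiveEigenfunction S lam π) (t : ℝ≥0) (x : E) :
    ∫⁻ ω, ENNReal.ofReal (S t ω) * ENNReal.ofReal (π (𝕏.X t ω)) ∂𝕏.P x
      = ENNReal.ofReal (Real.exp (-lam * t) * π x) := by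
  rw [← 𝕏.lintegral_prob x ((hS.measurable_payoff t hπ.measurable.ennreal_ofReal).mono
      (sigmaAt_le_sigmaInf t) le_rfl), ← hπ.eigen t x, pricingOp,
    ofReal_integral_eq_lintegral_ofReal (hπ.integrable t x)]
  · refine lintegral_congr_ae ?_
    filter_upwards [hS.pos x] with ω hω
    rw [ENNReal.ofReal_mul (hω t).le]
  · filter_upwards [hS.pos x] with ω hω
    exact (mul_pos (hω t) (hπ.pos _)).le

/-- The factorization solved for `M`, with `X_0 = x`; one null set serves all times. -/
theorem IsHansenScheinkmanFactorization.density_eq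
    (h : 𝕏.IsHansenScheinkmanFactorization S lam π M) (x : E) :
    ∀ᵐ ω ∂𝕏.prob x, ∀ t,
      M t ω = Real.exp (lam * t) / π x * (S t ω * π (𝕏.X t ω)) := by
  have h0 : ∀ᵐ ω ∂𝕏.prob x, 𝕏.X 0 ω = x := by
    rw [ae_prob]; exact 𝕏.normal x
  filter_upwards [h.factorization x, h0] with ω hω hω0 t
  have h1 := h.eigenfunction.pos x
  have h2 := h.eigenfunction.pos (𝕏.X t ω)
  rw [hω t, hω0, neg_mul, Real.exp_neg]
  have := Real.exp_pos (lam * t)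
  field_simp

/-- The Doob transform formula, which reduces statements about `Q` to the pricing kernel and the
laws `P_x`. -/
theorem IsHansenScheinkmanFactorization.lintegral_eigenTransition [Nonempty E]
    (hS : 𝕏.IsPricingKernel S) (h : 𝕏.IsHansenScheinkmanFactorization S lam π M) (t : ℝ≥0)
    (x : E) {g : E → ℝ≥0∞} (hg : Measurable g) :
    ∫⁻ z, g z ∂𝕏.eigenTransition M t x
      = ENNReal.ofReal (Real.exp (lam * t) / π x)
        * ∫⁻ ω, ENNReal.ofReal (S t ω) * (ENNReal.ofReal (π (𝕏.X t ω)) * g (𝕏.X t ω)) ∂𝕏.P x := by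
  have hπ := h.eigenfunction
  have hM : Measurable[𝕏.sigmaInf] fun ω => ENNReal.ofReal (M t ω) :=
    (((h.martingale x).1 t).measurable.ennreal_ofReal).mono (sigmaAt_le_sigmaInf t) le_rfl
  have hX : Measurable[𝕏.sigmaInf] (𝕏.X t) := (𝕏.measurable_X t).mono le_sigmaInf le_rfl
  have hpay : Measurable[𝕏.sigmaInf] fun ω =>
      ENNReal.ofReal (S t ω) * (ENNReal.ofReal (π (𝕏.X t ω)) * g (𝕏.X t ω)) :=
    (hS.measurable_payoff t (hπ.measurable.ennreal_ofReal.mul hg)).mono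
      (sigmaAt_le_sigmaInf t) le_rfl
  have hmap : ∫⁻ z, g z ∂𝕏.eigenTransition M t x
      = ∫⁻ ω, (g ∘ 𝕏.X t) ω ∂𝕏.eigenMeasure M t x :=
    @lintegral_map _ _ (𝕏.filtration t) _ _ _ _ hg (measurable_X_sigmaAt t)
  have htrim : ∫⁻ ω, (g ∘ 𝕏.X t) ω ∂𝕏.eigenMeasure M t x
      = ∫⁻ ω, (g ∘ 𝕏.X t) ω ∂(𝕏.prob x).withDensity fun ω => ENNReal.ofReal (M t ω) :=
    lintegral_trim (𝕏.filtration.le t) (hg.comp (measurable_X_sigmaAt t))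
  rw [hmap, htrim, lintegral_withDensity_eq_lintegral_mul _ hM (hg.comp hX), ← 𝕏.lintegral_prob x hpay,
    ← lintegral_const_mul _ hpay]
  refine lintegral_congr_ae ?_
  filter_upwards [h.density_eq x, hS.pos x] with ω h1 h2
  have := hπ.pos x
  simp only [Pi.mul_apply, Function.comp_apply]
  rw [h1 t, ENNReal.ofReal_mul (by positivity), ENNReal.ofReal_mul (h2 t).le]
  ring

theorem IsHansenScheinkmanFactorization.isProbabilityMeasure_eigenTransition [Nonempty E]
    (hS : 𝕏.IsPricingKernel S) (h : 𝕏.IsHansenScheinkmanFactorization S lam π M) (t : ℝ≥0)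
    (x : E) : IsProbabilityMeasure (𝕏.eigenTransition M t x) := by
  constructor
  have hπ := h.eigenfunction
  have hx := hπ.pos x
  have h1 := h.lintegral_eigenTransition hS t x (g := fun _ => 1) measurable_const
  simp only [mul_one, lintegral_const, one_mul] at h1
  rw [h1, hπ.lintegral_eq hS, ← ENNReal.ofReal_mul (by positivity)]
  have : Real.exp (lam * t) / π x * (Real.exp (-lam * t) * π x) = 1 := by
    rw [neg_mul, Real.exp_neg]
    have := Real.exp_pos (lam * t)
    field_simp
  rw [this, ENNReal.ofReal_one]

/-- Conditioning the payoff `S_{s+t} f(X_{s+t})` at time `s`. -/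
theorem IsPricingKernel.lintegral_add [Nonempty E] (hS : 𝕏.IsPricingKernel S) (s t : ℝ≥0) (x : E)
    {f : E → ℝ≥0∞} (hf : Measurable f) :
    ∫⁻ ω, ENNReal.ofReal (S (s + t) ω) * f (𝕏.X (s + t) ω) ∂𝕏.P x
      = ∫⁻ ω, ENNReal.ofReal (S s ω)
          * ∫⁻ ω', ENNReal.ofReal (S t ω') * f (𝕏.X t ω') ∂𝕏.P (𝕏.X s ω) ∂𝕏.P x := by
  have hmul := hS.multiplicative x s t
  have hpos := hS.pos x
  rw [ae_prob] at hmul hpos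
  rw [← 𝕏.lintegral_mul_comp_shift x s (hS.measurable_sigmaAt s).ennreal_ofReal
    ((hS.measurable_payoff t hf).mono (sigmaAt_le_sigmaInf t) le_rfl)]
  refine lintegral_congr_ae ?_
  filter_upwards [hmul, hpos] with ω h1 h2
  rw [h1, ENNReal.ofReal_mul (h2 s).le, 𝕏.shift, add_comm t s, mul_assoc]

theorem IsHansenScheinkmanFactorization.isUniversalTransition [Nonempty E]
    (hS : 𝕏.IsPricingKernel S) (h : 𝕏.IsHansenScheinkmanFactorization S lam π M) :
    IsUniversalTransition (𝕏.eigenTransition M) where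
  isProbabilityMeasure := h.isProbabilityMeasure_eigenTransition hS
  aemeasurable t g hg μ _ := by
    have hπ := h.eigenfunction
    simp only [h.lintegral_eigenTransition hS t _ hg]
    refine AEMeasurable.mul ?_ (𝕏.aemeasurable_lintegral μ
      ((hS.measurable_payoff t (hπ.measurable.ennreal_ofReal.mul hg)).mono
        (sigmaAt_le_sigmaInf t) le_rfl))
    exact (measurable_const.div hπ.measurable).ennreal_ofReal.aemeasurable
  chapman_kolmogorov s t x g hg := by
    have hπ := h.eigenfunction
    have hprob := h.isProbabilityMeasure_eigenTransition hS s x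
    set f : E → ℝ≥0∞ := fun z => ENNReal.ofReal (π z) * g z with hfdef
    have hf : Measurable f := hπ.measurable.ennreal_ofReal.mul hg
    set G : E → ℝ≥0∞ := fun y => ∫⁻ ω, ENNReal.ofReal (S t ω) * f (𝕏.X t ω) ∂𝕏.P y with hG
    have hGm : ∀ μ : Measure E, IsFiniteMeasure μ → AEMeasurable G μ := fun μ _ =>
      𝕏.aemeasurable_lintegral μ ((hS.measurable_payoff t hf).mono (sigmaAt_le_sigmaInf t) le_rfl)
    -- One Borel version of `G` for two laws: `Q_s(x, ·)` for the outer integral, and the law of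
    -- `X_s` under `P_x` for its expression through `S`.
    obtain ⟨G', hG', hGG'⟩ :=
      hGm (𝕏.eigenTransition M s x + (𝕏.P x).map (𝕏.X s)) inferInstance
    obtain ⟨hQ, hP⟩ := ae_add_measure_iff.1 hGG'
    have hP' := ae_of_ae_map (𝕏.measurable_X s).aemeasurable hP
    have hc : Measurable fun y => ENNReal.ofReal (Real.exp (lam * t) / π y) :=
      (measurable_const.div hπ.measurable).ennreal_ofReal
    have hright : ∫⁻ y, ∫⁻ z, g z ∂𝕏.eigenTransition M t y ∂𝕏.eigenTransition M s x
        = ∫⁻ y, ENNReal.ofReal (Real.exp (lam * t) / π y) * G' y ∂𝕏.eigenTransition M s x := by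
      refine lintegral_congr_ae ?_
      filter_upwards [hQ] with y hy
      rw [h.lintegral_eigenTransition hS t y hg, ← hy]
    rw [hright, h.lintegral_eigenTransition hS s x (g := fun y => _ * G' y) (hc.mul hG'),
      h.lintegral_eigenTransition hS (s + t) x hg]
    have hadd := hS.lintegral_add s t x hf
    simp only [hfdef] at hadd
    rw [hadd]
    have hin : ∫⁻ ω, ENNReal.ofReal (S s ω) * (ENNReal.ofReal (π (𝕏.X s ω))
          * (ENNReal.ofReal (Real.exp (lam * t) / π (𝕏.X s ω)) * G' (𝕏.X s ω))) ∂𝕏.P x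
        = ENNReal.ofReal (Real.exp (lam * t))
          * ∫⁻ ω, ENNReal.ofReal (S s ω) * G (𝕏.X s ω) ∂𝕏.P x := by
      rw [← lintegral_const_mul' _ _ ENNReal.ofReal_ne_top]
      refine lintegral_congr_ae ?_
      filter_upwards [hP'] with ω hω
      have hp := hπ.pos (𝕏.X s ω)
      rw [hω, ← mul_assoc (ENNReal.ofReal (π _)), ← ENNReal.ofReal_mul hp.le,
        mul_div_cancel₀ _ hp.ne']
      ring
    rw [hin, ← mul_assoc, ← ENNReal.ofReal_mul (by have := hπ.pos x; positivity)]
    congr 2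
    push_cast
    rw [mul_add, Real.exp_add]
    ring

/-- If two factorizations have eigenvalues `λ₁ ≤ λ₂` and the first is recurrent, the eigenvalues
agree and the eigenfunctions are proportional. -/
theorem IsRecurrentFactorization.eigenfunction_unique [Nonempty E] (hS : 𝕏.IsPricingKernel S)
    {lam' : ℝ} {π' : E → ℝ} (h : 𝕏.IsRecurrentFactorization S lam π M)
    (hπ' : 𝕏.IsPositiveEigenfunction S lam' π') (hle : lam ≤ lam') :
    lam = lam' ∧ ∃ a : ℝ, 0 < a ∧ ∀ x, π' x = a * π x := by
  have hπ := h.isFactorization.eigenfunction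
  have hQ := h.isFactorization.isUniversalTransition hS
  have hm : Measurable fun x => π' x / π x := hπ'.measurable.div hπ.measurable
  have hpos : ∀ x, 0 < π' x / π x := fun x => div_pos (hπ'.pos x) (hπ.pos x)
  -- In the Doob transform `π` cancels and leaves `𝒫_t π'`, whose eigenvalue combines with `e^{λt}`.
  have hlint : ∀ t x, ∫⁻ z, ENNReal.ofReal (π' z / π z) ∂𝕏.eigenTransition M t x
      = ENNReal.ofReal (Real.exp (-(lam' - lam) * t) * (π' x / π x)) := by
    intro t x
    rw [h.isFactorization.lintegral_eigenTransition hS t x hm.ennreal_ofReal]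
    have e : ∀ ω, ENNReal.ofReal (π (𝕏.X t ω)) * ENNReal.ofReal (π' (𝕏.X t ω) / π (𝕏.X t ω))
        = ENNReal.ofReal (π' (𝕏.X t ω)) := fun ω => by
      rw [← ENNReal.ofReal_mul (hπ.pos _).le, mul_div_cancel₀ _ (hπ.pos _).ne']
    simp only [e]
    rw [hπ'.lintegral_eq hS, ← ENNReal.ofReal_mul (by have := hπ.pos x; positivity)]
    congr 1
    rw [show -(lam' - lam) * (t : ℝ) = lam * t + -lam' * t by ring, Real.exp_add]
    ring
  have hint : ∀ t x, Integrable (fun z => π' z / π z) (𝕏.eigenTransition M t x) := by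
    intro t x
    refine (lintegral_ofReal_ne_top_iff_integrable hm.aestronglyMeasurable
      (Eventually.of_forall fun z => (hpos z).le)).1 ?_
    rw [hlint]
    exact ENNReal.ofReal_ne_top
  have heig : ∀ t x, ∫ z, π' z / π z ∂𝕏.eigenTransition M t x
      = Real.exp (-(lam' - lam) * t) * (π' x / π x) := by
    intro t x
    rw [integral_eq_lintegral_of_nonneg_ae (Eventually.of_forall fun z => (hpos z).le)
      hm.aestronglyMeasurable, hlint, ENNReal.toReal_ofReal (by have := hpos x; positivity)]
  obtain ⟨h0, a, ha, hconst⟩ :=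
    hQ.eigenfunction_const h.recurrent hm hpos hint (sub_nonneg.2 hle) heig
  refine ⟨by linarith, a, ha, fun x => ?_⟩
  rw [← hconst x, div_mul_cancel₀ _ (hπ.pos x).ne']

end BorelRightProcess

/-! ### Uniqueness of the recurrent factorization -/

theorem theorem3p2 {E Ω : Type*} [TopologicalSpace E] [MeasurableSpace E] [BorelSpace E]
    [LusinSpace E] [Nonempty E] [MeasurableSpace Ω] (𝕏 : BorelRightProcess E Ω)
    (S : ℝ≥0 → Ω → ℝ) (hS : 𝕏.IsPricingKernel S)
    (lam₁ lam₂ : ℝ) (π₁ π₂ : E → ℝ) (M₁ M₂ : ℝ≥0 → Ω → ℝ)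
    (h₁ : 𝕏.IsRecurrentFactorization S lam₁ π₁ M₁)
    (h₂ : 𝕏.IsRecurrentFactorization S lam₂ π₂ M₂) :
    lam₁ = lam₂ ∧
      (∃ c : ℝ, 0 < c ∧ ∀ x, π₁ x = c * π₂ x) ∧
      (∀ x, ∀ᵐ ω ∂(𝕏.prob x), ∀ t, M₁ t ω = M₂ t ω) ∧
      (∀ t x, 𝕏.eigenMeasure M₁ t x = 𝕏.eigenMeasure M₂ t x) := by
  have hπ₂ := h₂.isFactorization.eigenfunction
  have key : lam₁ = lam₂ ∧ ∃ c : ℝ, 0 < c ∧ ∀ x, π₁ x = c * π₂ x := by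
    -- The factorization with the smaller eigenvalue supplies the recurrent process.
    rcases le_total lam₁ lam₂ with hle | hle
    · obtain ⟨he, a, ha, h⟩ := h₁.eigenfunction_unique hS hπ₂ hle
      refine ⟨he, a⁻¹, inv_pos.2 ha, fun x => ?_⟩
      rw [h x, inv_mul_cancel_left₀ ha.ne']
    · obtain ⟨he, h⟩ := h₂.eigenfunction_unique hS h₁.isFactorization.eigenfunction hle
      exact ⟨he.symm, h⟩
  obtain ⟨rfl, c, hc, hπ⟩ := key
  have hM : ∀ x, ∀ᵐ ω ∂(𝕏.prob x), ∀ t, M₁ t ω = M₂ t ω := by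
    intro x
    -- The constant `c` cancels in `π(X_t) / π(x)`.
    filter_upwards [h₁.isFactorization.density_eq x, h₂.isFactorization.density_eq x]
      with ω e₁ e₂ t
    have hx := hπ₂.pos x
    rw [e₁ t, e₂ t, hπ, hπ]
    field_simp
  refine ⟨rfl, ⟨c, hc, hπ⟩, hM, fun t x => ?_⟩
  have : (𝕏.prob x).withDensity (fun ω => ENNReal.ofReal (M₁ t ω))
      = (𝕏.prob x).withDensity (fun ω => ENNReal.ofReal (M₂ t ω)) := by
    refine withDensity_congr_ae ?_
    filter_upwards [hM x] with ω hω
    rw [hω t]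
  rw [BorelRightProcess.eigenMeasure, BorelRightProcess.eigenMeasure, this]
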